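/- Let $q_0$ be a prime power, $q=q_0^2$, and let $m$ be a positive divisor of $q-1$. Let $\mathcal X_m$ be the non-singular projective model over $\mathbb F_q$ of the plane curve $$Y^{\frac{q-1}{m}}=X(X+1)^{q_0-1},$$ and let $t,z\in\mathbb F_q(\mathcal X_m)$ be the rational functions given by the coordinates $X$ and $Y$. Then there is exactly one point $\bar P_\infty$ of $\mathcal X_m$ at infinity, i.e. at which $t$ or $z$ has a pole. For a point $P$, let $H(P)$ denote the set of non-gaps at $P$, i.e. of the integers $n\ge 0$ such that some $f\in\mathbb F_q(\mathcal X_m)$ has pole divisor $(f)_\infty=nP$. Let $i,j\ge 0$ be integers with $i\ge j\,\frac{q_0+1}{m}$. Then $$iq_0-j\frac{q-1}{m}\in H(\bar P_\infty).$$ More precisely, this integer is non-negative, and the function $\gamma=z^i(t+1)^{-j}$ has pole divisor $(\gamma)_\infty=\bigl(iq_0-j\frac{q-1}{m}\bigr)\bar P_\infty$. Moreover, with $d=\gcd(m,q_0+1)$, the order of $\gamma$ is $i$ at every zero of $t$, it is $\frac{im-j(q_0+1)}{d}$ at every zero of $t+1$, and it is $0$ at every other point different from $\bar P_\infty$. (Points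 are the closed points of $\mathcal X_m$ over $\mathbb F_q$, i.e. the places of $\mathbb F_q(\mathcal X_m)$ over $\mathbb F_q$.) -/

import Mathlib

open Polynomial

section Places

variable (K F : Type*) [Field K] [Field F] [Algebra K F]

/-- A place of the function field `F` over the constant field `K`: a valuation ring of `F`
that contains `K` and is different from `F`.  The places of `F` over `K` are the (closed) points
of the non-singular projective curve over `K` with function field `F`. -/
@[ext]
structure Place where
  /-- the local ring of the point -/
  ring : ValuationSubring F
  algebraMap_mem : ∀ c : K, algebraMap K F c ∈ ring
  ne_top : ring ≠ ⊤

namespace Place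

variable {K F}

/-- `P.HasOrd f n` says that `ord_P f = n`: there is a local parameter `π` at `P` (a generator of
the maximal ideal of the local ring) such that `f = u * π ^ n` for a unit `u` of the local ring. -/
def HasOrd (P : Place K F) (f : F) (n : ℤ) : Prop :=
  ∃ π : P.ring, IsLocalRing.maximalIdeal P.ring = Ideal.span {π} ∧
    ∃ u : (P.ring)ˣ, f = ((u : P.ring) : F) * (π : F) ^ n

/-- `f` is regular at `P`. -/
def IsRegular (P : Place K F) (f : F) : Prop := f ∈ P.ring

/-- `P` is a zero of `f`. -/
def IsZero (P : Place K F) (f : F) : Prop :=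
  ∃ h : f ∈ P.ring, (⟨f, h⟩ : P.ring) ∈ IsLocalRing.maximalIdeal P.ring

/-- The pole divisor of the function `f` is `n P`: the order of `f` at `P` is `-n`, and `f` is
regular at all other places. -/
def HasPoleDivisor (P : Place K F) (f : F) (n : ℕ) : Prop :=
  P.HasOrd f (-(n : ℤ)) ∧ ∀ Q : Place K F, Q ≠ P → Q.IsRegular f

/-- The Weierstrass semigroup `H(P)` of the non-gaps at `P`. -/
def nonGaps (P : Place K F) : Set ℕ := {n | ∃ f : F, P.HasPoleDivisor f n}

end Place

end Places

namespace CurveE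

variable (K : Type*) [Field K] (q₀ m : ℕ)

/-- The polynomial `Y ^ ((q - 1) / m) - X (X + 1) ^ (q₀ - 1)`, where `q = q₀ ^ 2`; the inner
variable is `X`, the outer one is `Y`. -/
noncomputable def polynomial : K[X][X] :=
  X ^ ((q₀ ^ 2 - 1) / m) - C (X * (X + 1) ^ (q₀ - 1))

/-- The affine coordinate ring of the plane curve `Y ^ ((q - 1) / m) = X (X + 1) ^ (q₀ - 1)`. -/
abbrev CoordinateRing : Type _ := AdjoinRoot (polynomial K q₀ m)

/-- The function field of the plane curve `Y ^ ((q - 1) / m) = X (X + 1) ^ (q₀ - 1)`. -/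
abbrev FunctionField : Type _ := FractionRing (CoordinateRing K q₀ m)

theorem exponent_ne_zero [hq : Fact (IsPrimePow q₀)] [hm : Fact (m ∣ q₀ ^ 2 - 1)] :
    (q₀ ^ 2 - 1) / m ≠ 0 := by
  have h1 : 1 < q₀ := hq.out.one_lt
  have h2 : 0 < q₀ ^ 2 - 1 := by
    have : 1 < q₀ ^ 2 := Nat.one_lt_pow (by norm_num) h1
    omega
  have h3 := Nat.div_mul_cancel hm.out
  intro h0
  rw [h0] at h3
  omega

theorem irreducible_polynomial [Fact (IsPrimePow q₀)] [Fact (m ∣ q₀ ^ 2 - 1)] :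
    Irreducible (polynomial K q₀ m) := by
  have hn := exponent_ne_zero q₀ m
  unfold polynomial
  have hmonic : (X ^ ((q₀ ^ 2 - 1) / m) - C (X * (X + 1) ^ (q₀ - 1)) : K[X][X]).Monic :=
    monic_X_pow_sub_C _ hn
  have hX : (Ideal.span {(X : K[X])}).IsPrime :=
    (Ideal.span_singleton_prime X_ne_zero).2 prime_X
  refine irreducible_of_eisenstein_criterion hX ?_ ?_ ?_ ?_ hmonic.isPrimitive
  · rw [hmonic.leadingCoeff]
    exact fun h => hX.ne_top ((Ideal.eq_top_iff_one _).2 h)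
  · intro k hk
    rw [degree_X_pow_sub_C (Nat.pos_of_ne_zero hn)] at hk
    have hk' : k ≠ (q₀ ^ 2 - 1) / m := by
      have : k < (q₀ ^ 2 - 1) / m := by exact_mod_cast hk
      omega
    rw [coeff_sub, coeff_X_pow, if_neg hk', coeff_C, zero_sub]
    refine neg_mem ?_
    split_ifs
    · exact Ideal.mul_mem_right _ _ (Ideal.mem_span_singleton_self _)
    · exact zero_mem _
  · rw [degree_X_pow_sub_C (Nat.pos_of_ne_zero hn)]
    exact_mod_cast Nat.pos_of_ne_zero hn
  · rw [coeff_sub, coeff_X_pow, if_neg (Ne.symm hn), coeff_C_zero, zero_sub, neg_mem_iff,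
      Ideal.span_singleton_pow, Ideal.mem_span_singleton, pow_two,
      mul_dvd_mul_iff_left X_ne_zero]
    intro h
    have h' := prime_X.dvd_of_dvd_pow h
    rw [X_dvd_iff] at h'
    simp at h'

instance [Fact (IsPrimePow q₀)] [Fact (m ∣ q₀ ^ 2 - 1)] : IsDomain (CoordinateRing K q₀ m) :=
  AdjoinRoot.isDomain_of_prime (irreducible_polynomial K q₀ m).prime

/-- The coordinate function `X` of the plane curve, as a rational function. -/
noncomputable def t : FunctionField K q₀ m :=
  algebraMap (CoordinateRing K q₀ m) _ (AdjoinRoot.of (polynomial K q₀ m) X)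

/-- The coordinate function `Y` of the plane curve, as a rational function. -/
noncomputable def z : FunctionField K q₀ m :=
  algebraMap (CoordinateRing K q₀ m) _ (AdjoinRoot.root (polynomial K q₀ m))

/-- The place `P` of the function field lies at infinity: one of the two affine
coordinate functions of the plane curve has a pole at `P`. -/
def IsAtInfinity [Fact (IsPrimePow q₀)] [Fact (m ∣ q₀ ^ 2 - 1)]
    (P : Place K (FunctionField K q₀ m)) : Prop :=
  ¬ (P.IsRegular (t K q₀ m) ∧ P.IsRegular (z K q₀ m))

end CurveE

/-!
Put `n = (q - 1) / m`, so that `z ^ n = t (t + 1) ^ (q₀ - 1)`. The order of `γ = z ^ i (t + 1) ^ (-j)`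
at a place is read off from a local parameter there, and the places fall into four kinds.

* Over `t = 0`, the function `z` is a local parameter.
* Over `t = ∞`, a suitable product of `t ^ m / z ^ q₀` with a power of `1 + t⁻¹` is a local parameter
  `u`, and `u ^ n` is `t⁻¹` times a unit, since `n m = q₀ ^ 2 - 1`.
* Over `t = -1`, write `n = g n'` and `q₀ - 1 = g r'` with `r'` and `n'` coprime. The function
  `W = z ^ n' / (t + 1) ^ r'` satisfies `W ^ g = t`, so `t + 1 = W ^ g + 1` has simple zeros on the
  `W`-line, and a monomial `u` in `z` and `t + 1` satisfies `u ^ n' = W ^ a (t + 1)`.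
* At all other places, `t`, `t + 1` and `z` are units, and `γ` has order `0`.

In the first three cases the function field is generated by `u` over a rational function field
`K(w)`, and `u ^ e` is a polynomial in `w` divisible exactly once by the irreducible polynomial `π`
at which the place is centred. The terms of `∑ f i (w) u ^ i`, `i < e`, then have distinct orders,
whence every function is a unit times a power of `u`, with an exponent that depends only on `π`
(`exists_valuation_eq_zpow`). This gives at once that the place is discrete with uniformizer `u`, and
that it is the only one above `π`; in particular there is at most one place at infinity. There is
one because the local ring of `K[t⁻¹]` at the origin is dominated by some valuation ring. At the
remaining places a local parameter exists because the function field is separable over `K(t)`, so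
that the integral closure of `K[t]` is a Dedekind domain (`exists_hasUniformizer_of_pow_eq_aeval`).
-/

/-! ### Uniformizers of valuation rings -/

section Uniformizers

variable {F : Type*} [Field F]

/-- `u` is a uniformizer of the valuation ring `V`: it is a nonzero non-unit, and every nonzero
element of the field is a unit of `V` times an integral power of `u`. -/
structure ValuationSubring.HasUniformizer (V : ValuationSubring F) (u : F) : Prop where
  ne_zero : u ≠ 0
  lt_one : V.valuation u < 1
  exists_zpow : ∀ x : F, x ≠ 0 → ∃ k : ℤ, V.valuation x = V.valuation u ^ k

theorem ValuationSubring.HasUniformizer.valuation_pos {V : ValuationSubring F} {u : F}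
    (hu : V.HasUniformizer u) : 0 < V.valuation u :=
  zero_lt_iff.2 ((Valuation.ne_zero_iff _).2 hu.ne_zero)

theorem ValuationSubring.HasUniformizer.zpow_le_one_iff {V : ValuationSubring F} {u : F}
    (hu : V.HasUniformizer u) (k : ℤ) : V.valuation u ^ k ≤ 1 ↔ 0 ≤ k := by
  have := zpow_right_strictAnti₀ hu.valuation_pos hu.lt_one
  simpa using this.le_iff_ge (a := k) (b := 0)

theorem Place.hasOrd_of_valuation_eq {K : Type*} [Field K] [Algebra K F] (P : Place K F) {u f : F}
    (hu : P.ring.HasUniformizer u) {n : ℤ} (hf : P.ring.valuation f = P.ring.valuation u ^ n) :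
    P.HasOrd f n := by
  have huP : u ∈ P.ring := (P.ring.valuation_le_one_iff u).1 hu.lt_one.le
  refine ⟨⟨u, huP⟩, le_antisymm ?_ ?_, ?_⟩
  · intro x hx
    rw [Ideal.mem_span_singleton']
    rw [ValuationSubring.valuation_lt_one_iff] at hx
    obtain rfl | hx0 := eq_or_ne x 0
    · exact ⟨0, by simp⟩
    obtain ⟨k, hk⟩ := hu.exists_zpow x (by simpa using hx0)
    have hk1 : 1 ≤ k := by
      by_contra! h
      have := (zpow_right_strictAnti₀ hu.valuation_pos hu.lt_one).antitone
        (show k ≤ 0 by omega)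
      simp only [zpow_zero] at this
      exact absurd hx (not_lt.2 (hk ▸ this))
    have hle : P.ring.valuation x ≤ P.ring.valuation u := by
      rw [hk]
      simpa using (zpow_right_strictAnti₀ hu.valuation_pos hu.lt_one).antitone hk1
    obtain ⟨a, ha⟩ := (P.ring.valuation_le_iff _ _).1 hle
    exact ⟨a, Subtype.ext ha⟩
  · rw [Ideal.span_singleton_le_iff_mem, ValuationSubring.valuation_lt_one_iff]
    exact hu.lt_one
  · rw [← map_zpow₀] at hf
    obtain ⟨a, ha⟩ := (P.ring.valuation_eq_iff _ _).1 hf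
    exact ⟨a, ha.symm⟩

theorem Place.isZero_iff {K : Type*} [Field K] [Algebra K F] (P : Place K F) (f : F) :
    P.IsZero f ↔ P.ring.valuation f < 1 := by
  constructor
  · rintro ⟨h, hf⟩
    exact (P.ring.valuation_lt_one_iff _).1 hf
  · intro h
    exact ⟨(P.ring.valuation_le_one_iff f).1 h.le, (P.ring.valuation_lt_one_iff _).2 h⟩

/-- A valuation ring which is different from the field and contains a Dedekind domain with the
same field of fractions is the localization of this domain at a maximal ideal, hence discrete. -/
theorem ValuationSubring.exists_hasUniformizer_of_isDedekindDomain (V : ValuationSubring F)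
    (hV : V ≠ ⊤) (A : Type*) [CommRing A] [IsDedekindDomain A] [Algebra A F] [IsFractionRing A F]
    (hA : ∀ a : A, algebraMap A F a ∈ V) : ∃ u, V.HasUniformizer u := by
  let φ : A →+* V := (algebraMap A F).codRestrict V.toSubring hA
  have hφ : ∀ a, ((φ a : V) : F) = algebraMap A F a := fun a => rfl
  let 𝔭 : Ideal A := (IsLocalRing.maximalIdeal V).comap φ
  have hmem : ∀ a, a ∈ 𝔭 ↔ V.valuation (algebraMap A F a) < 1 := fun a => by
    rw [← hφ, ← ValuationSubring.valuation_lt_one_iff]; rfl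
  have hunit : ∀ a, a ∉ 𝔭 → V.valuation (algebraMap A F a) = 1 := fun a ha =>
    le_antisymm ((V.valuation_le_one_iff _).2 (hA a)) (not_lt.1 (fun h => ha ((hmem a).2 h)))
  -- If the centre `𝔭` of `V` on `A` were zero, then `V` would contain all fractions of `A`.
  have h𝔭 : 𝔭 ≠ ⊥ := by
    intro h
    refine hV (_root_.eq_top_iff.2 fun x _ => ?_)
    obtain ⟨a, b, hb, rfl⟩ := IsFractionRing.div_surjective (A := A) x
    have hb' : b ∉ 𝔭 := by
      rw [h, Ideal.mem_bot]; exact nonZeroDivisors.ne_zero hb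
    rw [← V.valuation_le_one_iff, map_div₀, hunit b hb', div_one]
    exact (V.valuation_le_one_iff _).2 (hA a)
  let v : IsDedekindDomain.HeightOneSpectrum A := ⟨𝔭, inferInstance, h𝔭⟩
  have hint : ∀ x : F, v.valuation F x ≤ 1 → V.valuation x ≤ 1 := by
    intro x hx
    obtain ⟨n, d, h⟩ := v.exists_primeCompl_mul_eq_of_integer x hx
    have := congrArg V.valuation h
    rw [map_mul, hunit d d.2, mul_one] at this
    rw [this]
    exact (V.valuation_le_one_iff _).2 (hA n)
  have hone : ∀ x : F, v.valuation F x = 1 → V.valuation x = 1 := by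
    intro x hx
    refine le_antisymm (hint x hx.le) ?_
    have h0 : x ≠ 0 := by rintro rfl; simp at hx
    have := hint x⁻¹ (by rw [map_inv₀, hx, inv_one])
    rw [map_inv₀] at this
    exact (inv_le_one₀ (zero_lt_iff.2 ((Valuation.ne_zero_iff _).2 h0))).1 this
  obtain ⟨ϖ, hϖ⟩ := v.valuation_exists_uniformizer' F
  change v.valuation F (algebraMap A F ϖ) = _ at hϖ
  have hϖ0 : algebraMap A F ϖ ≠ 0 := by
    intro h; rw [h, map_zero] at hϖ; exact WithZero.exp_ne_zero hϖ.symm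
  refine ⟨algebraMap A F ϖ, hϖ0, ?_, fun x hx => ?_⟩
  · rw [← hmem]
    refine (v.valuation_lt_one_iff_mem (K := F) ϖ).1 ?_
    rw [hϖ, ← WithZero.exp_zero, WithZero.exp_lt_exp]; norm_num
  · have hvx : v.valuation F x ≠ 0 := (Valuation.ne_zero_iff _).2 hx
    refine ⟨-WithZero.log (v.valuation F x), ?_⟩
    have := hone (x / (algebraMap A F ϖ) ^ (-WithZero.log (v.valuation F x))) (by
      rw [map_div₀, map_zpow₀, hϖ, ← WithZero.exp_zsmul]
      simp only [smul_eq_mul, mul_neg, neg_neg, mul_one]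
      rw [WithZero.exp_log hvx, div_self hvx])
    rw [map_div₀, map_zpow₀, div_eq_one_iff_eq] at this
    · exact this
    · exact zpow_ne_zero _ ((Valuation.ne_zero_iff _).2 hϖ0)

end Uniformizers

/-! ### Totally ramified extensions of a rational function field -/

section TotallyRamified

variable {K F : Type*} [Field K] [Field F] [Algebra K F]

/-- The valuation ring `V` contains `K[w]`, and `π` lies in the contraction of its maximal ideal
to `K[w]`. -/
structure ValuationSubring.IsCenteredAt (V : ValuationSubring F) (w : F) (π : K[X]) : Prop where
  algebraMap_mem : ∀ c : K, algebraMap K F c ∈ V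
  mem : w ∈ V
  lt_one : V.valuation (aeval w π) < 1

theorem ValuationSubring.aeval_mem {V : ValuationSubring F}
    (hK : ∀ c : K, algebraMap K F c ∈ V) {w : F} (hw : w ∈ V) (f : K[X]) : aeval w f ∈ V := by
  rw [aeval_eq_sum_range]
  refine sum_mem fun i _ => ?_
  rw [Algebra.smul_def]
  exact V.mul_mem _ _ (hK _) (pow_mem hw i)

theorem ValuationSubring.IsCenteredAt.valuation_eq_one {V : ValuationSubring F} {w : F} {π : K[X]}
    (h : V.IsCenteredAt w π) (hπ : Irreducible π) {f : K[X]} (hf : ¬ π ∣ f) :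
    V.valuation (aeval w f) = 1 := by
  obtain ⟨a, b, hab⟩ := (hπ.coprime_iff_not_dvd).2 hf
  have hle : ∀ g : K[X], V.valuation (aeval w g) ≤ 1 := fun g =>
    (V.valuation_le_one_iff _).2 (ValuationSubring.aeval_mem h.algebraMap_mem h.mem g)
  refine le_antisymm (hle f) (not_lt.1 fun hlt => ?_)
  -- Otherwise the Bézout combination `a * π + b * f = 1` would be a non-unit of `V`.
  have h1 : V.valuation (aeval w (a * π + b * f)) < 1 := by
    rw [map_add, map_mul, map_mul]
    refine (Valuation.map_add _ _ _).trans_lt (max_lt ?_ ?_) <;> rw [map_mul]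
    · exact mul_lt_one_of_nonneg_of_lt_one_right (hle a) zero_le h.lt_one
    · exact mul_lt_one_of_nonneg_of_lt_one_right (hle b) zero_le hlt
  rw [hab, map_one, map_one] at h1
  exact lt_irrefl _ h1

/-- A polynomial expression in `w` and `u`, where `u ^ e` is a polynomial in `w`, has degree less
than `e` in `u`. -/
theorem exists_eq_sum_of_mem_adjoin {w u : F} {r : K[X]} {e : ℕ} (he : 0 < e)
    (hu : u ^ e = aeval w r) {a : F} (ha : a ∈ Algebra.adjoin K {w, u}) :
    ∃ f : ℕ → K[X], a = ∑ i ∈ Finset.range e, aeval w (f i) * u ^ i := by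
  have hrange : Algebra.adjoin K {w, u} ≤ (aevalAeval (R := K) w u).range := by
    refine Algebra.adjoin_le ?_
    rintro x (rfl | rfl)
    · exact ⟨C X, aevalAeval_X _ _⟩
    · exact ⟨X, aevalAeval_Y _ _⟩
  obtain ⟨p, rfl⟩ := hrange ha
  have hmonic : (X ^ e - C r : K[X][X]).Monic := monic_X_pow_sub_C _ he.ne'
  have hzero : aevalAeval w u (X ^ e - C r : K[X][X]) = 0 := by
    rw [map_sub, map_pow, aevalAeval_Y, aevalAeval_C, hu, sub_self]
  refine ⟨fun i => (p %ₘ (X ^ e - C r)).coeff i, ?_⟩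
  have hdeg : (p %ₘ (X ^ e - C r)).natDegree < e := by
    have := natDegree_modByMonic_lt p hmonic (by
      intro h; have := congrArg natDegree h; rw [natDegree_X_pow_sub_C, natDegree_one] at this
      omega)
    rwa [natDegree_X_pow_sub_C] at this
  conv_lhs => rw [← modByMonic_add_div p (X ^ e - C r)]
  change aevalAeval w u _ = _
  rw [map_add, map_mul, hzero, zero_mul, add_zero]
  conv_lhs => rw [as_sum_range_C_mul_X_pow' _ hdeg]
  rw [map_sum]
  exact Finset.sum_congr rfl fun i _ => by rw [map_mul, map_pow, aevalAeval_C, aevalAeval_Y]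

variable {w u : F} {π r : K[X]} {e : ℕ}

theorem ValuationSubring.IsCenteredAt.valuation_eq_pow {V : ValuationSubring F}
    (h : V.IsCenteredAt w π) (hπ : Irreducible π) (hr : ¬ π ∣ r)
    (hu : u ^ e = aeval w (π * r)) : V.valuation (aeval w π) = V.valuation u ^ e := by
  rw [← map_pow, hu, map_mul, map_mul, h.valuation_eq_one hπ hr, mul_one]

theorem ValuationSubring.IsCenteredAt.valuation_lt_one {V : ValuationSubring F}
    (h : V.IsCenteredAt w π) (hπ : Irreducible π) (hr : ¬ π ∣ r)
    (hu : u ^ e = aeval w (π * r)) : V.valuation u < 1 := by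
  have h1 := h.lt_one
  rw [h.valuation_eq_pow hπ hr hu] at h1
  by_contra! h2
  exact absurd h1 (not_lt.2 (one_le_pow₀ h2))

/-- The terms `f i * u ^ i` of a polynomial expression have pairwise distinct orders, as these
orders are pairwise incongruent modulo `e`; so the smallest of them is the order of the sum. -/
theorem exists_valuation_eq_pow_of_mem_adjoin (hπ : Irreducible π) (hr : ¬ π ∣ r)
    (he : 0 < e) (hu : u ^ e = aeval w (π * r)) (hu0 : u ≠ 0) {a : F}
    (ha : a ∈ Algebra.adjoin K {w, u}) (ha0 : a ≠ 0) :
    ∃ k : ℕ, ∀ V : ValuationSubring F, V.IsCenteredAt w π → V.valuation a = V.valuation u ^ k := by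
  classical
  obtain ⟨f, rfl⟩ := exists_eq_sum_of_mem_adjoin he hu ha
  have hfac : ∀ i, ∃ n : ℕ, ∃ g, f i ≠ 0 → ¬ π ∣ g ∧ f i = π ^ n * g := fun i => by
    by_cases h : f i = 0
    · exact ⟨0, 0, fun h' => absurd h h'⟩
    · obtain ⟨n, g, hg⟩ := WfDvdMonoid.max_power_factor h hπ
      exact ⟨n, g, fun _ => hg⟩
  choose n g hg using hfac
  let s := (Finset.range e).filter fun i => f i ≠ 0
  have hsum : ∑ i ∈ Finset.range e, aeval w (f i) * u ^ i = ∑ i ∈ s, aeval w (f i) * u ^ i := by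
    refine (Finset.sum_subset (Finset.filter_subset _ _) fun i hi his => ?_).symm
    have : f i = 0 := by
      by_contra h; exact his (Finset.mem_filter.2 ⟨hi, h⟩)
    simp [this]
  rw [hsum] at ha0 ⊢
  have hs : s.Nonempty := by
    rw [Finset.nonempty_iff_ne_empty]; intro h; rw [h] at ha0; simp at ha0
  obtain ⟨j, hj, hmin⟩ := s.exists_min_image (fun i => e * n i + i) hs
  refine ⟨e * n j + j, fun V hV => ?_⟩
  have hval : ∀ i ∈ s, V.valuation (aeval w (f i) * u ^ i) = V.valuation u ^ (e * n i + i) := by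
    intro i hi
    obtain ⟨h1, h2⟩ := hg i (Finset.mem_filter.1 hi).2
    rw [map_mul, h2, map_mul, map_pow, map_mul, map_pow, hV.valuation_eq_one hπ h1,
      hV.valuation_eq_pow hπ hr hu, mul_one, ← pow_mul, map_pow, ← pow_add]
  rw [Valuation.map_sum_eq_of_lt _ hj, hval j hj]
  intro i hi
  obtain ⟨his, hij⟩ := Finset.mem_sdiff.1 hi
  rw [hval i his, hval j hj]
  refine pow_lt_pow_right_of_lt_one₀ (zero_lt_iff.2 ((Valuation.ne_zero_iff _).2 hu0))
    (hV.valuation_lt_one hπ hr hu) (lt_of_le_of_ne (hmin i his) fun h => ?_)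
  have hje : j < e := Finset.mem_range.1 (Finset.mem_filter.1 hj).1
  have hie : i < e := Finset.mem_range.1 (Finset.mem_filter.1 his).1
  have := congrArg (· % e) h
  simp only [Nat.mul_add_mod, Nat.mod_eq_of_lt hje, Nat.mod_eq_of_lt hie] at this
  exact hij (by simp [this])

/-- The exponent `k` does not depend on `V`, so that there is at most one such valuation ring. -/
theorem exists_valuation_eq_zpow (hπ : Irreducible π) (hr : ¬ π ∣ r)
    (he : 0 < e) (hu : u ^ e = aeval w (π * r)) (hu0 : u ≠ 0)
    (htop : IntermediateField.adjoin K {w, u} = ⊤) {x : F} (hx : x ≠ 0) :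
    ∃ k : ℤ, ∀ V : ValuationSubring F, V.IsCenteredAt w π → V.valuation x = V.valuation u ^ k := by
  have hmem : x ∈ IntermediateField.adjoin K {w, u} := htop ▸ IntermediateField.mem_top
  obtain ⟨a, ha, b, hb, rfl⟩ := IntermediateField.mem_adjoin_iff_div.1 hmem
  obtain ⟨k, hk⟩ := exists_valuation_eq_pow_of_mem_adjoin hπ hr he hu hu0 ha
    (by rintro rfl; simp at hx)
  obtain ⟨l, hl⟩ := exists_valuation_eq_pow_of_mem_adjoin hπ hr he hu hu0 hb
    (by rintro rfl; simp at hx)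
  refine ⟨k - l, fun V hV => ?_⟩
  rw [map_div₀, hk V hV, hl V hV, zpow_sub₀ ((Valuation.ne_zero_iff _).2 hu0), zpow_natCast,
    zpow_natCast]

theorem ValuationSubring.IsCenteredAt.hasUniformizer {V : ValuationSubring F}
    (h : V.IsCenteredAt w π) (hπ : Irreducible π) (hr : ¬ π ∣ r)
    (he : 0 < e) (hu : u ^ e = aeval w (π * r)) (hu0 : u ≠ 0)
    (htop : IntermediateField.adjoin K {w, u} = ⊤) : V.HasUniformizer u :=
  ⟨hu0, h.valuation_lt_one hπ hr hu, fun _ hx =>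
    (exists_valuation_eq_zpow hπ hr he hu hu0 htop hx).imp fun _ hk => hk V h⟩

theorem ValuationSubring.IsCenteredAt.unique {V W : ValuationSubring F}
    (hV : V.IsCenteredAt w π) (hW : W.IsCenteredAt w π) (hπ : Irreducible π) (hr : ¬ π ∣ r)
    (he : 0 < e) (hu : u ^ e = aeval w (π * r)) (hu0 : u ≠ 0)
    (htop : IntermediateField.adjoin K {w, u} = ⊤) : V = W := by
  ext x
  obtain rfl | hx := eq_or_ne x 0
  · simp
  obtain ⟨k, hk⟩ := exists_valuation_eq_zpow hπ hr he hu hu0 htop hx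
  rw [← V.valuation_le_one_iff, ← W.valuation_le_one_iff, hk V hV, hk W hW,
    (hV.hasUniformizer hπ hr he hu hu0 htop).zpow_le_one_iff,
    (hW.hasUniformizer hπ hr he hu hu0 htop).zpow_le_one_iff]

end TotallyRamified

/-! ### Existence of places, and discreteness in separable Kummer extensions -/

section FunctionFields

variable {K F : Type*} [Field K] [Field F] [Algebra K F]

theorem exists_valuationSubring_valuation_lt_one {s : F} (hs : Transcendental K s) :
    ∃ V : ValuationSubring F, (∀ c : K, algebraMap K F c ∈ V) ∧ V.valuation s < 1 := by
  let A : Subring F := (aeval s : K[X] →ₐ[K] F).range.toSubring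
  have hsA : s ∈ A := ⟨X, aeval_X s⟩
  obtain ⟨V, hAV, hV⟩ := Ideal.image_subset_nonunits_valuationSubring
    (Ideal.span {(⟨s, hsA⟩ : A)}) (by
      rw [Ne, Ideal.span_singleton_eq_top, isUnit_iff_exists_inv]
      rintro ⟨⟨_, g, rfl⟩, hb⟩
      have h1 : aeval s (X * g - 1 : K[X]) = 0 := by
        rw [map_sub, map_mul, aeval_X, map_one, sub_eq_zero]
        exact congrArg Subtype.val hb
      have h2 : (X * g - 1 : K[X]) = 0 := (transcendental_iff.1 hs) _ h1
      have h3 := congrArg (Polynomial.eval 0) h2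
      simp at h3)
  refine ⟨V, fun c => hAV ⟨C c, aeval_C s c⟩, ?_⟩
  exact V.mem_nonunits_iff.1 (hV ⟨_, Ideal.mem_span_singleton_self _, rfl⟩)

/-- In a separable Kummer extension of the field of fractions of a Dedekind domain `A`, every
valuation ring above `A` is discrete, because it contains the integral closure of `A`, which is
a Dedekind domain again. -/
theorem exists_hasUniformizer_of_pow_eq_algebraMap (A E : Type*) [CommRing A] [IsDedekindDomain A]
    [Field E] [Algebra A E] [IsFractionRing A E] [Algebra A F] [Algebra E F] [IsScalarTower A E F]
    {z : F} {n : ℕ} (hn : (n : E) ≠ 0) {c : A} (hz : z ^ n = algebraMap A F c) (hz0 : z ≠ 0)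
    (htop : IntermediateField.adjoin E {z} = ⊤) {V : ValuationSubring F} (hV : V ≠ ⊤)
    (hA : ∀ a : A, algebraMap A F a ∈ V) : ∃ u, V.HasUniformizer u := by
  have hc : algebraMap E F (algebraMap A E c) = z ^ n :=
    hz ▸ (IsScalarTower.algebraMap_apply A E F c).symm
  have hc0 : algebraMap A E c ≠ 0 := by
    intro h
    rw [h, map_zero] at hc
    exact pow_ne_zero n hz0 hc.symm
  have hroot : aeval z (X ^ n - C (algebraMap A E c)) = 0 := by
    rw [map_sub, map_pow, aeval_X, aeval_C, hc, sub_self]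
  have hsep : IsSeparable E z :=
    (separable_X_pow_sub_C _ hn hc0).of_dvd (minpoly.dvd _ _ hroot)
  have : Algebra.IsSeparable E F := by
    rw [← separableClosure.eq_top_iff, _root_.eq_top_iff, ← htop,
      IntermediateField.adjoin_simple_le_iff]
    exact hsep
  have : FiniteDimensional E F := by
    have := IntermediateField.adjoin.finiteDimensional hsep.isIntegral
    rw [htop] at this
    exact IntermediateField.topEquiv.toLinearEquiv.finiteDimensional
  have : IsFractionRing (integralClosure A F) F :=
    integralClosure.isFractionRing_of_finite_extension E F
  have : IsDedekindDomain (integralClosure A F) := integralClosure.isDedekindDomain A E F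
  refine V.exists_hasUniformizer_of_isDedekindDomain hV (integralClosure A F) fun a => ?_
  let φ : A →+* V := (algebraMap A F).codRestrict V.toSubring hA
  obtain ⟨p, hp, hpa⟩ := a.2
  have hint : IsIntegral V (a : F) := ⟨p.map φ, hp.map φ, by rw [eval₂_map]; exact hpa⟩
  obtain ⟨y, hy⟩ := IsIntegrallyClosed.isIntegral_iff.1 hint
  have hmem : (a : F) ∈ V := hy ▸ y.2
  exact hmem

theorem exists_hasUniformizer_of_pow_eq_aeval {t z : F} (ht : Transcendental K t) {n : ℕ}
    (hn : (n : K) ≠ 0) {c : K[X]} (hz : z ^ n = aeval t c) (hz0 : z ≠ 0)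
    (htop : IntermediateField.adjoin K {t, z} = ⊤) {V : ValuationSubring F} (hV : V ≠ ⊤)
    (hK : ∀ c : K, algebraMap K F c ∈ V) (htV : t ∈ V) : ∃ u, V.HasUniformizer u := by
  let : Algebra K[X] F := (aeval t : K[X] →ₐ[K] F).toRingHom.toAlgebra
  have hmap : ∀ f : K[X], algebraMap K[X] F f = aeval t f := fun f => rfl
  have : FaithfulSMul K[X] F := (faithfulSMul_iff_algebraMap_injective _ _).2
    (transcendental_iff_injective.1 ht)
  let : Algebra (FractionRing K[X]) F := FractionRing.liftAlgebra K[X] F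
  have : IsScalarTower K[X] (FractionRing K[X]) F := FractionRing.isScalarTower_liftAlgebra K[X] F
  have hmap' : ∀ f : K[X], algebraMap (FractionRing K[X]) F (algebraMap K[X] _ f) = aeval t f :=
    fun f => (IsScalarTower.algebraMap_apply K[X] (FractionRing K[X]) F f).symm
  have hnE : (n : FractionRing K[X]) ≠ 0 := by
    intro h
    have h1 := congrArg (algebraMap (FractionRing K[X]) F) h
    rw [map_natCast, map_zero, ← map_natCast (algebraMap K F), map_eq_zero] at h1
    exact hn h1
  refine exists_hasUniformizer_of_pow_eq_algebraMap K[X] (FractionRing K[X]) hnE hz hz0 ?_ hV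
    fun a => ValuationSubring.aeval_mem hK htV a
  have hmem : ∀ f : K[X], aeval t f ∈ IntermediateField.adjoin (FractionRing K[X]) {z} := fun f =>
    hmap' f ▸ IntermediateField.algebraMap_mem _ _
  let L : IntermediateField K F :=
    { (IntermediateField.adjoin (FractionRing K[X]) {z}).toSubfield with
      algebraMap_mem' := fun c => by
        have := hmem (C c)
        rwa [aeval_C] at this }
  have h1 : IntermediateField.adjoin K {t, z} ≤ L := by
    rw [IntermediateField.adjoin_le_iff]
    rintro x (rfl | rfl)
    · have := hmem X
      rwa [aeval_X] at this
    · exact IntermediateField.mem_adjoin_simple_self (FractionRing K[X]) _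
  rw [_root_.eq_top_iff]
  intro x _
  exact h1 (htop ▸ IntermediateField.mem_top)

end FunctionFields

/-! ### Local parameters on Kummer curves with branch points `0`, `-1` and `∞` -/

section Curve

variable {K F : Type*} [Field K] [Field F] [Algebra K F]

theorem exists_irreducible_dvd_isCenteredAt {V : ValuationSubring F}
    (hK : ∀ c : K, algebraMap K F c ∈ V) {w : F} (hw : w ∈ V) {P : K[X]} (hP : P ≠ 0)
    (hlt : V.valuation (aeval w P) < 1) :
    ∃ π : K[X], Irreducible π ∧ π ∣ P ∧ V.IsCenteredAt w π := by
  let φ : K[X] →+* V := ((aeval w : K[X] →ₐ[K] F) : K[X] →+* F).codRestrict V.toSubring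
    fun f => ValuationSubring.aeval_mem hK hw f
  let I : Ideal K[X] := (IsLocalRing.maximalIdeal V).comap φ
  have hmem : ∀ f, f ∈ I ↔ V.valuation (aeval w f) < 1 := fun f => by
    change φ f ∈ IsLocalRing.maximalIdeal V ↔ _
    rw [ValuationSubring.valuation_lt_one_iff]; rfl
  have hPI : P ∈ I := (hmem P).2 hlt
  have hI : I ≠ ⊥ := by
    intro h
    rw [h, Ideal.mem_bot] at hPI
    exact hP hPI
  exact ⟨Submodule.IsPrincipal.generator I,
    (Submodule.IsPrincipal.prime_generator_of_isPrime I hI).irreducible,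
    (Submodule.IsPrincipal.mem_iff_generator_dvd I).1 hPI, hK, hw,
    (hmem _).1 (Submodule.IsPrincipal.generator_mem I)⟩

theorem adjoin_pair_eq_top {t z w u : F} (htop : IntermediateField.adjoin K {t, z} = ⊤)
    (ht : t ∈ IntermediateField.adjoin K {w, u}) (hz : z ∈ IntermediateField.adjoin K {w, u}) :
    IntermediateField.adjoin K {w, u} = ⊤ := by
  rw [_root_.eq_top_iff, ← htop, IntermediateField.adjoin_le_iff]
  rintro x (rfl | rfl)
  exacts [ht, hz]

variable {t z : F}

theorem hasUniformizer_at_zero {n N : ℕ} (htop : IntermediateField.adjoin K {t, z} = ⊤)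
    (hz0 : z ≠ 0) (hn : 0 < n) (hz : z ^ n = t * (t + 1) ^ N) {V : ValuationSubring F}
    (hK : ∀ c : K, algebraMap K F c ∈ V) (ht : V.valuation t < 1) :
    V.HasUniformizer z ∧ V.valuation (t + 1) = 1 := by
  have hc : V.IsCenteredAt t (X : K[X]) :=
    ⟨hK, (V.valuation_le_one_iff _).1 ht.le, by rwa [aeval_X]⟩
  refine ⟨hc.hasUniformizer irreducible_X (r := (X + 1) ^ N) ?_ hn ?_ hz0 htop, ?_⟩
  · rw [X_dvd_iff, coeff_zero_eq_eval_zero]; simp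
  · simp [hz]
  · rw [add_comm, Valuation.map_one_add_of_lt _ ht]

/-- With `W = z ^ n / (t + 1) ^ r` one has `W ^ g = t`, so that the function field is an extension
of degree `n` of the rational function field `K(W)`, totally ramified at the zeros of `t + 1`, while
`K(W)` is unramified over `K(t)` there. -/
theorem exists_hasUniformizer_at_neg_one {g n r : ℕ}
    (htop : IntermediateField.adjoin K {t, z} = ⊤) (hz0 : z ≠ 0) (hs0 : t + 1 ≠ 0) (hn : 0 < n)
    (hg : (g : K) ≠ 0) (hnr : Nat.Coprime r n) (hz : z ^ (g * n) = t * (t + 1) ^ (g * r))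
    {V : ValuationSubring F} (hK : ∀ c : K, algebraMap K F c ∈ V)
    (hs : V.valuation (t + 1) < 1) :
    ∃ u, V.HasUniformizer u ∧ V.valuation z = V.valuation u ^ r ∧
      V.valuation (t + 1) = V.valuation u ^ n := by
  have hg0 : g ≠ 0 := by rintro rfl; simp at hg
  obtain ⟨a, b, hab⟩ : ∃ (a : ℕ) (b : ℤ), (a : ℤ) * r + b * n = 1 := by
    obtain ⟨a, b, hab⟩ := Nat.isCoprime_iff_coprime.2 hnr
    -- Adding a multiple of `n` to the first Bézout coefficient makes it nonnegative.
    have hnonneg : 0 ≤ a + n * |a| := by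
      have h1 : (1 : ℤ) ≤ n := by exact_mod_cast hn
      nlinarith [abs_nonneg a, neg_abs_le a]
    refine ⟨(a + n * |a|).toNat, b - r * |a|, ?_⟩
    rw [Int.toNat_of_nonneg hnonneg]
    linear_combination hab
  set s := t + 1 with hs_def
  have htval : V.valuation t = 1 := by
    have : t = -(1 - s) := by rw [hs_def]; ring
    rw [this, Valuation.map_neg, Valuation.map_one_sub_of_lt _ hs]
  set W := z ^ n / s ^ r with hW
  have hWg : W ^ g = t := by
    rw [hW, div_pow, ← pow_mul, ← pow_mul, mul_comm n, mul_comm r, hz,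
      mul_div_cancel_right₀ _ (pow_ne_zero _ hs0)]
  have hWval : V.valuation W = 1 := by
    rw [← pow_eq_one_iff_of_nonneg zero_le hg0, ← map_pow, hWg, htval]
  have hW0 : W ≠ 0 := div_ne_zero (pow_ne_zero _ hz0) (pow_ne_zero _ hs0)
  have hWz : W = z ^ (n : ℤ) * s ^ (-(r : ℤ)) := by
    rw [hW, zpow_neg, zpow_natCast, zpow_natCast, div_eq_mul_inv]
  have hP : aeval W (X ^ g - C (-1) : K[X]) = s := by
    simp [hWg, hs_def]
  obtain ⟨π, hπ, ⟨P', hP'⟩, hc⟩ := exists_irreducible_dvd_isCenteredAt hK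
    ((V.valuation_le_one_iff _).1 hWval.le)
    (monic_X_pow_sub_C (-1 : K) hg0).ne_zero (hP ▸ hs)
  -- `π` does not divide `X ^ a` as `W` is a unit, nor `P'` as `X ^ g + 1` is squarefree.
  have hdvd : ¬ π ∣ X ^ a * P' := by
    intro h
    rcases hπ.prime.dvd_or_dvd h with ⟨Q, hQ⟩ | ⟨Q, hQ⟩
    · have h1 : V.valuation (aeval W (X ^ a : K[X])) < 1 := by
        rw [hQ, map_mul, map_mul]
        exact mul_lt_one_of_nonneg_of_lt_one_left zero_le hc.lt_one
          ((V.valuation_le_one_iff _).2 (ValuationSubring.aeval_mem hK hc.mem Q))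
      rw [map_pow, aeval_X, map_pow, hWval, one_pow] at h1
      exact lt_irrefl _ h1
    · refine hπ.not_isUnit ((separable_X_pow_sub_C (-1 : K) hg (by simp)).squarefree π ⟨Q, ?_⟩)
      rw [hP', hQ, mul_assoc]
  set u := z ^ a * s ^ b with hu_def
  have hu0 : u ≠ 0 := mul_ne_zero (pow_ne_zero _ hz0) (zpow_ne_zero _ hs0)
  have huz : u = z ^ (a : ℤ) * s ^ b := by rw [hu_def, zpow_natCast]
  have hun : u ^ n = W ^ a * s := by
    rw [← zpow_natCast u, ← zpow_natCast W, huz, hWz, mul_zpow, mul_zpow, ← zpow_mul, ← zpow_mul,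
      ← zpow_mul, ← zpow_mul, mul_assoc, ← zpow_add_one₀ hs0]
    congr 2
    · ring
    · linear_combination hab
  have hzu : z = u ^ r * W ^ b := by
    rw [← zpow_natCast u, huz, hWz, mul_zpow, mul_zpow, ← zpow_mul, ← zpow_mul,
      ← zpow_mul, ← zpow_mul, mul_mul_mul_comm, ← zpow_add₀ hz0, ← zpow_add₀ hs0,
      show (a : ℤ) * r + n * b = 1 by linear_combination hab,
      show b * (r : ℤ) + -r * b = 0 by ring, zpow_one, zpow_zero, mul_one]
  have hu : u ^ n = aeval W (π * (X ^ a * P')) := by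
    rw [hun, mul_left_comm, ← hP', map_mul, hP, map_pow, aeval_X]
  have htop' : IntermediateField.adjoin K {W, u} = ⊤ := by
    have hWm : W ∈ IntermediateField.adjoin K {W, u} :=
      IntermediateField.subset_adjoin _ _ (by simp)
    have hum : u ∈ IntermediateField.adjoin K {W, u} :=
      IntermediateField.subset_adjoin _ _ (by simp)
    refine adjoin_pair_eq_top htop (hWg ▸ pow_mem hWm g) ?_
    rw [hzu]
    exact mul_mem (pow_mem hum _) (zpow_mem hWm _)
  refine ⟨u, hc.hasUniformizer hπ hdvd hn hu hu0 htop', ?_, ?_⟩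
  · conv_lhs => rw [hzu]
    rw [map_mul, map_pow, map_zpow₀, hWval, one_zpow, mul_one]
  · rw [← map_pow, hun, map_mul, map_pow, hWval, one_pow, one_mul]

/-- The function `u` is a local parameter at infinity: up to a power of `1 + t⁻¹` it equals
`t ^ m / z ^ q₀`. -/
theorem exists_parameter_at_infinity {q₀ n m : ℕ} (htop : IntermediateField.adjoin K {t, z} = ⊤)
    (ht0 : t ≠ 0) (hs0 : t + 1 ≠ 0) (hn : 0 < n) (hq₀ : 0 < q₀) (hnm : n * m + 1 = q₀ ^ 2)
    (hz0 : z ≠ 0) (hz : z ^ n = t * (t + 1) ^ (q₀ - 1)) :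
    ∃ (u : F) (r : K[X]), u ≠ 0 ∧ u ^ n = aeval t⁻¹ (X * r) ∧ ¬ X ∣ r ∧
      IntermediateField.adjoin K {t⁻¹, u} = ⊤ := by
  obtain ⟨k, rfl⟩ : ∃ k, q₀ = k + 1 := ⟨q₀ - 1, by omega⟩
  obtain ⟨l, rfl⟩ : ∃ l, n = l + 1 := ⟨n - 1, by omega⟩
  rw [Nat.add_sub_cancel] at hz
  have hc0 : 1 + t⁻¹ ≠ 0 := by
    have : 1 + t⁻¹ = (t + 1) / t := by field_simp
    rw [this]
    exact div_ne_zero hs0 ht0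
  have hts : t + 1 = t * (1 + t⁻¹) := by field_simp
  set u := t ^ m / z ^ (k + 1) * (1 + t⁻¹) ^ ((k + 1) * k) with hu_def
  have hu0 : u ≠ 0 :=
    mul_ne_zero (div_ne_zero (pow_ne_zero _ ht0) (pow_ne_zero _ hz0)) (pow_ne_zero _ hc0)
  refine ⟨u, (1 + X) ^ ((k + 1) * k * l), hu0, ?_, ?_, ?_⟩
  · have h1 : (z ^ (k + 1)) ^ (l + 1) = t ^ ((l + 1) * m + 1) * (1 + t⁻¹) ^ ((k + 1) * k) := by
      rw [← pow_mul, mul_comm (k + 1), pow_mul, hz, hts, hnm]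
      generalize 1 + t⁻¹ = c
      ring
    rw [hu_def, mul_pow, div_pow, h1, map_mul, aeval_X, map_pow, map_add, map_one, aeval_X]
    have h2 : ((1 + t⁻¹) ^ ((k + 1) * k)) ^ (l + 1) =
        (1 + t⁻¹) ^ ((k + 1) * k) * (1 + t⁻¹) ^ ((k + 1) * k * l) := by ring
    have h3 : t ^ ((l + 1) * m + 1) = (t ^ m) ^ (l + 1) * t := by ring
    rw [h2, h3]
    have := pow_ne_zero ((k + 1) * k) hc0
    generalize (1 + t⁻¹) ^ ((k + 1) * k) = A at *
    generalize (1 + t⁻¹) ^ ((k + 1) * k * l) = B at *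
    field_simp
  · rw [X_dvd_iff, coeff_zero_eq_eval_zero]; simp
  · have htm : t ∈ IntermediateField.adjoin K {t⁻¹, u} := by
      have : t⁻¹ ∈ IntermediateField.adjoin K {t⁻¹, u} :=
        IntermediateField.subset_adjoin _ _ (by simp)
      simpa using inv_mem this
    have hum : u ∈ IntermediateField.adjoin K {t⁻¹, u} :=
      IntermediateField.subset_adjoin _ _ (by simp)
    refine adjoin_pair_eq_top htop htm ?_
    have hzk : z ^ (k + 1) = t ^ m * (1 + t⁻¹) ^ ((k + 1) * k) / u := by
      rw [hu_def]
      have := pow_ne_zero ((k + 1) * k) hc0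
      field_simp
    have hzkm : z ^ (k + 1) ∈ IntermediateField.adjoin K {t⁻¹, u} := by
      rw [hzk]
      exact div_mem (mul_mem (pow_mem htm _) (pow_mem (add_mem (one_mem _) (inv_mem htm)) _)) hum
    have hznm : z ^ (l + 1) ∈ IntermediateField.adjoin K {t⁻¹, u} := by
      rw [hz]
      exact mul_mem htm (pow_mem (add_mem htm (one_mem _)) _)
    -- `z` is recovered from the coprime powers `z ^ q₀` and `z ^ n`, as `q₀ * q₀ - n * m = 1`.
    have hzz : z = (z ^ (k + 1)) ^ (k + 1) / (z ^ (l + 1)) ^ m := by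
      rw [eq_div_iff (pow_ne_zero _ (pow_ne_zero _ hz0)), ← pow_mul, ← pow_mul, ← pow_succ',
        hnm, pow_two]
    rw [hzz]
    exact div_mem (pow_mem hzkm _) (pow_mem hznm _)

theorem ValuationSubring.isCenteredAt_inv {V : ValuationSubring F}
    (hK : ∀ c : K, algebraMap K F c ∈ V) (ht : t ∉ V) : V.IsCenteredAt t⁻¹ (X : K[X]) := by
  have h : V.valuation t⁻¹ < 1 := V.mem_nonunits_iff.1 (V.inv_mem_nonunits_iff.2 (Or.inr ht))
  exact ⟨hK, (V.valuation_le_one_iff _).1 h.le, by rwa [aeval_X]⟩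

theorem exists_hasUniformizer_at_infinity {q₀ n m : ℕ}
    (htop : IntermediateField.adjoin K {t, z} = ⊤)
    (ht0 : t ≠ 0) (hs0 : t + 1 ≠ 0) (hn : 0 < n) (hq₀ : 0 < q₀) (hnm : n * m + 1 = q₀ ^ 2)
    (hz0 : z ≠ 0) (hz : z ^ n = t * (t + 1) ^ (q₀ - 1)) {V : ValuationSubring F}
    (hK : ∀ c : K, algebraMap K F c ∈ V) (ht : t ∉ V) :
    ∃ u, V.HasUniformizer u ∧ V.valuation z = V.valuation u ^ (-q₀ : ℤ) ∧
      V.valuation (t + 1) = V.valuation u ^ (-n : ℤ) := by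
  obtain ⟨u, r, hu0, hu, hr, htop'⟩ :=
    exists_parameter_at_infinity htop ht0 hs0 hn hq₀ hnm hz0 hz
  have hc := ValuationSubring.isCenteredAt_inv hK ht
  have hU := hc.hasUniformizer irreducible_X hr hn hu hu0 htop'
  have ht' : V.valuation t = V.valuation u ^ (-n : ℤ) := by
    have h1 := hc.valuation_eq_pow irreducible_X hr hu
    rw [aeval_X, map_inv₀] at h1
    rw [zpow_neg, zpow_natCast, ← h1, inv_inv]
  have hs : V.valuation (t + 1) = V.valuation u ^ (-n : ℤ) := by
    rw [← ht']
    refine Valuation.map_add_eq_of_lt_left _ ?_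
    rw [map_one]
    exact not_le.1 fun h => ht ((V.valuation_le_one_iff _).1 h)
  refine ⟨u, hU, ?_, hs⟩
  obtain ⟨k, hk⟩ := hU.exists_zpow z hz0
  have h1 := congrArg V.valuation hz
  rw [map_pow, map_mul, map_pow, hs, ht', hk, ← zpow_natCast, ← zpow_natCast, ← zpow_mul,
    ← zpow_mul, ← zpow_add₀ hU.valuation_pos.ne'] at h1
  have h2 := (zpow_right_strictAnti₀ hU.valuation_pos hU.lt_one).injective h1
  have h3 : ((q₀ - 1 : ℕ) : ℤ) = q₀ - 1 := by omega
  rw [h3] at h2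
  have h4 : (n : ℤ) * (k + q₀) = 0 := by linear_combination h2
  have h5 : k = -q₀ := by
    rcases mul_eq_zero.1 h4 with h | h <;> omega
  rw [hk, h5]

end Curve

/-! ### Numerical properties of the exponents -/

namespace CurveE

theorem exponent_mul_add_one {q₀ m : ℕ} [Fact (IsPrimePow q₀)] [Fact (m ∣ q₀ ^ 2 - 1)] :
    (q₀ ^ 2 - 1) / m * m + 1 = q₀ ^ 2 := by
  rw [Nat.div_mul_cancel Fact.out]
  have := Nat.one_le_pow 2 q₀ (Fact.out : IsPrimePow q₀).pos
  omega

/-- The exponents `(q - 1) / m` and `q₀ - 1` of the curve have a common factor `g`, with coprime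
cofactors `(q₀ + 1) / d` and `m / d`, where `d = gcd(m, q₀ + 1)`. -/
theorem exists_exponent_eq_mul (q₀ m : ℕ) [Fact (IsPrimePow q₀)] [Fact (m ∣ q₀ ^ 2 - 1)] :
    ∃ g n r : ℕ, 0 < n ∧ 0 < Nat.gcd m (q₀ + 1) ∧ Nat.Coprime r n ∧
      (q₀ ^ 2 - 1) / m = g * n ∧ q₀ - 1 = g * r ∧
      m = r * Nat.gcd m (q₀ + 1) ∧ q₀ + 1 = n * Nat.gcd m (q₀ + 1) := by
  have hd : 0 < Nat.gcd m (q₀ + 1) := Nat.gcd_pos_of_pos_right _ (Nat.succ_pos _)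
  obtain ⟨r, n, hrn, hr, hn⟩ := Nat.exists_coprime m (q₀ + 1)
  have hn0 : 0 < n := by
    rcases Nat.eq_zero_or_pos n with h | h
    · rw [h] at hn; omega
    · exact h
  have hm : 0 < m := by
    have := exponent_mul_add_one (q₀ := q₀) (m := m)
    have h1 := (Fact.out : IsPrimePow q₀).one_lt
    rcases Nat.eq_zero_or_pos m with rfl | h
    · simp only [mul_zero, zero_add] at this; nlinarith
    · exact h
  have hr0 : 0 < r := by
    rcases Nat.eq_zero_or_pos r with h | h
    · rw [h] at hr; omega
    · exact h
  obtain ⟨k, hk⟩ : ∃ k, q₀ = k + 1 := ⟨q₀ - 1, by have := (Fact.out : IsPrimePow q₀).pos; omega⟩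
  have hprod : (q₀ ^ 2 - 1) / m * r = (q₀ - 1) * n := by
    have h1 := exponent_mul_add_one (q₀ := q₀) (m := m)
    have h2 : (q₀ ^ 2 - 1) / m * m = (q₀ - 1) * (q₀ + 1) := by
      have : (q₀ - 1) * (q₀ + 1) + 1 = q₀ ^ 2 := by
        rw [hk, Nat.add_sub_cancel]; ring
      omega
    refine Nat.eq_of_mul_eq_mul_right hd ?_
    rw [mul_assoc, mul_assoc, ← hr, ← hn, h2]
  obtain ⟨g, hg⟩ : n ∣ (q₀ ^ 2 - 1) / m :=
    hrn.symm.dvd_of_dvd_mul_right (Dvd.intro_left _ hprod.symm)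
  refine ⟨g, n, r, hn0, hd, hrn, by rw [hg, mul_comm], ?_, hr, hn⟩
  rw [hg] at hprod
  refine Nat.eq_of_mul_eq_mul_right hn0 ?_
  rw [← hprod]; ring

theorem cast_eq_zero_of_card {K : Type*} [Field K] [Finite K] {q₀ : ℕ}
    (hK : Nat.card K = q₀ ^ 2) : (q₀ : K) = 0 := by
  have := Fintype.ofFinite K
  have h := FiniteField.cast_card_eq_zero K
  rw [← Nat.card_eq_fintype_card, hK, Nat.cast_pow] at h
  exact pow_eq_zero_iff (two_ne_zero) |>.1 h

/-- A natural number dividing `q₀ ^ k - 1`, for some `k > 0`, is invertible in a field of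
characteristic dividing `q₀`. -/
theorem cast_ne_zero_of_mul_add_one_eq_pow {K : Type*} [Field K] {q₀ : ℕ} (hq : (q₀ : K) = 0)
    {a b k : ℕ} (hk : k ≠ 0) (h : a * b + 1 = q₀ ^ k) : (a : K) ≠ 0 := by
  intro ha
  have h1 := congrArg (Nat.cast : ℕ → K) h
  rw [Nat.cast_add, Nat.cast_mul, ha, zero_mul, zero_add, Nat.cast_one, Nat.cast_pow, hq,
    zero_pow hk] at h1
  exact one_ne_zero h1

end CurveE

/-! ### The function field of the curve -/

namespace CurveE

variable (K : Type*) [Field K] (q₀ m : ℕ)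

theorem algebraMap_eq (c : K) : algebraMap K (FunctionField K q₀ m) c =
    algebraMap (CoordinateRing K q₀ m) _ (AdjoinRoot.of (polynomial K q₀ m) (C c)) := rfl

theorem aeval_t (f : K[X]) : aeval (t K q₀ m) f =
    algebraMap (CoordinateRing K q₀ m) _ (AdjoinRoot.of (polynomial K q₀ m) f) := by
  induction f using Polynomial.induction_on' with
  | add p q hp hq => rw [map_add, hp, hq, map_add, map_add]
  | monomial n a =>
    rw [aeval_monomial, algebraMap_eq, t, ← map_pow, ← map_mul, ← map_pow, ← map_mul,
      C_mul_X_pow_eq_monomial]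

theorem z_pow : z K q₀ m ^ ((q₀ ^ 2 - 1) / m) = t K q₀ m * (t K q₀ m + 1) ^ (q₀ - 1) := by
  have h : AdjoinRoot.root (polynomial K q₀ m) ^ ((q₀ ^ 2 - 1) / m) =
      AdjoinRoot.of (polynomial K q₀ m) (X * (X + 1) ^ (q₀ - 1)) := by
    have := AdjoinRoot.eval₂_root (polynomial K q₀ m)
    conv at this => enter [1, 3]; rw [polynomial]
    rwa [eval₂_sub, eval₂_X_pow, eval₂_C, sub_eq_zero] at this
  rw [z, ← map_pow, h, t]
  simp only [map_mul, map_pow, map_add, map_one]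

variable [Fact (IsPrimePow q₀)] [Fact (m ∣ q₀ ^ 2 - 1)]

theorem transcendental_t : Transcendental K (t K q₀ m) := by
  rw [transcendental_iff_injective]
  intro f g h
  rw [aeval_t, aeval_t] at h
  refine AdjoinRoot.of.injective_of_degree_ne_zero ?_ (IsFractionRing.injective _ _ h)
  rw [polynomial, degree_X_pow_sub_C (Nat.pos_of_ne_zero (exponent_ne_zero q₀ m))]
  exact_mod_cast exponent_ne_zero q₀ m

theorem adjoin_t_z : IntermediateField.adjoin K {t K q₀ m, z K q₀ m} = ⊤ := by
  have ht : t K q₀ m ∈ IntermediateField.adjoin K {t K q₀ m, z K q₀ m} :=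
    IntermediateField.subset_adjoin _ _ (by simp)
  have hz : z K q₀ m ∈ IntermediateField.adjoin K {t K q₀ m, z K q₀ m} :=
    IntermediateField.subset_adjoin _ _ (by simp)
  have hmem : ∀ a : CoordinateRing K q₀ m, algebraMap _ (FunctionField K q₀ m) a ∈
      IntermediateField.adjoin K {t K q₀ m, z K q₀ m} := by
    intro a
    induction a using AdjoinRoot.induction_on with
    | ih p =>
      induction p using Polynomial.induction_on' with
      | add p q hp hq => rw [map_add, map_add]; exact add_mem hp hq
      | monomial n f =>
        rw [← C_mul_X_pow_eq_monomial, map_mul, map_pow, AdjoinRoot.mk_X, AdjoinRoot.mk_C,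
          map_mul, map_pow, ← aeval_t]
        refine mul_mem ?_ (pow_mem hz _)
        have := (aeval (⟨t K q₀ m, ht⟩ : IntermediateField.adjoin K {t K q₀ m, z K q₀ m}) f).2
        rwa [← IntermediateField.aeval_coe] at this
  rw [_root_.eq_top_iff]
  intro x _
  obtain ⟨a, b, _, rfl⟩ := IsFractionRing.div_surjective (A := CoordinateRing K q₀ m) x
  exact div_mem (hmem a) (hmem b)

theorem t_ne_zero : t K q₀ m ≠ 0 := fun h =>
  X_ne_zero (transcendental_iff.1 (transcendental_t K q₀ m) X (by rw [aeval_X, h]))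

theorem t_add_one_ne_zero : t K q₀ m + 1 ≠ 0 := by
  intro h
  have h1 : aeval (t K q₀ m) (X + 1 : K[X]) = 0 := by simpa using h
  exact (monic_X_add_C (1 : K)).ne_zero
    (by simpa using transcendental_iff.1 (transcendental_t K q₀ m) _ h1)

theorem z_ne_zero : z K q₀ m ≠ 0 := by
  intro h
  have h1 := z_pow K q₀ m
  rw [h, zero_pow (exponent_ne_zero q₀ m)] at h1
  exact mul_ne_zero (t_ne_zero K q₀ m) (pow_ne_zero _ (t_add_one_ne_zero K q₀ m)) h1.symm

variable {K q₀ m}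

theorem isAtInfinity_iff (P : Place K (FunctionField K q₀ m)) :
    IsAtInfinity K q₀ m P ↔ t K q₀ m ∉ P.ring := by
  refine ⟨fun h ht => h ⟨ht, ?_⟩, fun h h' => h h'.1⟩
  have hz : z K q₀ m ^ ((q₀ ^ 2 - 1) / m) ∈ P.ring := by
    rw [z_pow]
    exact P.ring.mul_mem _ _ ht (pow_mem (P.ring.add_mem _ _ ht P.ring.one_mem) _)
  rw [← P.ring.valuation_le_one_iff, map_pow] at hz
  exact (P.ring.valuation_le_one_iff _).1
    ((pow_le_one_iff_of_nonneg zero_le (exponent_ne_zero q₀ m)).1 hz)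

end CurveE

/-! ### The place at infinity -/

namespace CurveE

variable (K : Type*) [Field K] (q₀ m : ℕ) [Fact (IsPrimePow q₀)] [Fact (m ∣ q₀ ^ 2 - 1)]

theorem existsUnique_isAtInfinity :
    ∃! P : Place K (FunctionField K q₀ m), IsAtInfinity K q₀ m P := by
  have ht := transcendental_t K q₀ m
  have hinv : Transcendental K (t K q₀ m)⁻¹ := fun h => ht (by simpa using h.inv)
  obtain ⟨V, hK, hV⟩ := exists_valuationSubring_valuation_lt_one hinv
  have htV : t K q₀ m ∉ V :=
    (V.inv_mem_nonunits_iff.1 (V.mem_nonunits_iff.2 hV)).resolve_left (t_ne_zero K q₀ m)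
  refine ⟨⟨V, hK, fun h => htV (h ▸ ValuationSubring.mem_top _)⟩,
    (isAtInfinity_iff _).2 htV, fun P hP => ?_⟩
  have hn := Nat.pos_of_ne_zero (exponent_ne_zero q₀ m)
  obtain ⟨u, r, hu0, hu, hr, htop⟩ := exists_parameter_at_infinity (adjoin_t_z K q₀ m)
    (t_ne_zero K q₀ m) (t_add_one_ne_zero K q₀ m) hn (Fact.out : IsPrimePow q₀).pos
    exponent_mul_add_one (z_ne_zero K q₀ m) (z_pow K q₀ m)
  exact Place.ext ((ValuationSubring.isCenteredAt_inv P.algebraMap_mem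
    ((isAtInfinity_iff P).1 hP)).unique (ValuationSubring.isCenteredAt_inv hK htV)
    irreducible_X hr hn hu hu0 htop)

end CurveE

/-! ### The divisor of `z ^ i (t + 1) ^ (-j)` -/

theorem mainTheorem8 (K : Type*) [Field K] [Finite K] (q₀ m : ℕ)
    [Fact (IsPrimePow q₀)] [Fact (m ∣ q₀ ^ 2 - 1)] (hK : Nat.card K = q₀ ^ 2)
    (i j : ℕ) (hij : (i : ℚ) ≥ (j : ℚ) * (((q₀ : ℚ) + 1) / (m : ℚ))) :
    (∃! P : Place K (CurveE.FunctionField K q₀ m), CurveE.IsAtInfinity K q₀ m P) ∧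
    ∀ Pinf : Place K (CurveE.FunctionField K q₀ m), CurveE.IsAtInfinity K q₀ m Pinf →
      ∃ k : ℕ, (k : ℤ) = (i : ℤ) * (q₀ : ℤ) - (j : ℤ) * (((q₀ ^ 2 - 1) / m : ℕ) : ℤ) ∧
        k ∈ Pinf.nonGaps ∧
        Pinf.HasPoleDivisor (CurveE.z K q₀ m ^ i * (CurveE.t K q₀ m + 1) ^ (-(j : ℤ))) k ∧
        ∀ Q : Place K (CurveE.FunctionField K q₀ m), Q ≠ Pinf →
          (Q.IsZero (CurveE.t K q₀ m) →
            Q.HasOrd (CurveE.z K q₀ m ^ i * (CurveE.t K q₀ m + 1) ^ (-(j : ℤ))) (i : ℤ)) ∧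
          (Q.IsZero (CurveE.t K q₀ m + 1) →
            Q.HasOrd (CurveE.z K q₀ m ^ i * (CurveE.t K q₀ m + 1) ^ (-(j : ℤ)))
              (((i : ℤ) * (m : ℤ) - (j : ℤ) * ((q₀ : ℤ) + 1)) / (Nat.gcd m (q₀ + 1) : ℤ))) ∧
          (¬ Q.IsZero (CurveE.t K q₀ m) → ¬ Q.IsZero (CurveE.t K q₀ m + 1) →
            Q.HasOrd (CurveE.z K q₀ m ^ i * (CurveE.t K q₀ m + 1) ^ (-(j : ℤ))) 0) := by
  refine ⟨CurveE.existsUnique_isAtInfinity K q₀ m, fun Pinf hPinf => ?_⟩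
  have htop := CurveE.adjoin_t_z K q₀ m
  have ht0 := CurveE.t_ne_zero K q₀ m
  have hs0 := CurveE.t_add_one_ne_zero K q₀ m
  have hz0 := CurveE.z_ne_zero K q₀ m
  have hz := CurveE.z_pow K q₀ m
  have htr := CurveE.transcendental_t K q₀ m
  have hn := Nat.pos_of_ne_zero (CurveE.exponent_ne_zero q₀ m)
  have hnm := CurveE.exponent_mul_add_one (q₀ := q₀) (m := m)
  have hq0 : 1 < q₀ := (Fact.out : IsPrimePow q₀).one_lt
  have hqK := CurveE.cast_eq_zero_of_card hK
  obtain ⟨g, n, r, hn0, hd, hrn, hgn, hgr, hm, hq⟩ := CurveE.exists_exponent_eq_mul q₀ m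
  have hnK : (((q₀ ^ 2 - 1) / m : ℕ) : K) ≠ 0 :=
    CurveE.cast_ne_zero_of_mul_add_one_eq_pow hqK two_ne_zero hnm
  have hgK : (g : K) ≠ 0 :=
    CurveE.cast_ne_zero_of_mul_add_one_eq_pow hqK (b := r) one_ne_zero (by rw [pow_one]; omega)
  have hm0 : 0 < m := by
    rcases Nat.eq_zero_or_pos m with h | h
    · rw [h] at hnm; simp only [mul_zero, zero_add] at hnm; nlinarith
    · exact h
  -- The order at the zeros of `t + 1`, and its sign.
  have hdiv : ((i : ℤ) * (m : ℤ) - (j : ℤ) * ((q₀ : ℤ) + 1)) / (Nat.gcd m (q₀ + 1) : ℤ) =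
      i * r - j * n := by
    have hm' : (m : ℤ) = r * (Nat.gcd m (q₀ + 1) : ℤ) := by exact_mod_cast hm
    have hq' : (q₀ : ℤ) + 1 = n * (Nat.gcd m (q₀ + 1) : ℤ) := by exact_mod_cast hq
    refine Int.ediv_eq_of_eq_mul_left (by exact_mod_cast hd.ne') ?_
    linear_combination (i : ℤ) * hm' - (j : ℤ) * hq'
  have hle : (j : ℤ) * (q₀ + 1) ≤ i * m := by
    rw [ge_iff_le, ← mul_div_assoc, div_le_iff₀ (by exact_mod_cast hm0)] at hij
    exact_mod_cast hij
  have hnonneg : (0 : ℤ) ≤ i * r - j * n := by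
    rw [← hdiv]
    exact Int.ediv_nonneg (by linarith) (by positivity)
  have hk : (0 : ℤ) ≤ (i : ℤ) * (q₀ : ℤ) - (j : ℤ) * (((q₀ ^ 2 - 1) / m : ℕ) : ℤ) := by
    have hnm' : (((q₀ ^ 2 - 1) / m : ℕ) : ℤ) * m + 1 = (q₀ : ℤ) ^ 2 := by exact_mod_cast hnm
    generalize (((q₀ ^ 2 - 1) / m : ℕ) : ℤ) = N at *
    have h1 : (0 : ℤ) ≤ (i * q₀ - j * N) * m := by
      have h2 : ((i : ℤ) * q₀ - j * N) * m =
          q₀ * (i * m - j * (q₀ + 1)) + j * (q₀ + 1) := by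
        linear_combination -(j : ℤ) * hnm'
      rw [h2]
      have h3 : (0 : ℤ) ≤ i * m - j * (q₀ + 1) := by linarith
      positivity
    exact nonneg_of_mul_nonneg_left h1 (by exact_mod_cast hm0)
  set γ := CurveE.z K q₀ m ^ i * (CurveE.t K q₀ m + 1) ^ (-(j : ℤ)) with hγ
  have hγval : ∀ (V : ValuationSubring (CurveE.FunctionField K q₀ m)) (u) (a b : ℤ),
      V.HasUniformizer u → V.valuation (CurveE.z K q₀ m) = V.valuation u ^ a →
      V.valuation (CurveE.t K q₀ m + 1) = V.valuation u ^ b →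
      V.valuation γ = V.valuation u ^ (i * a - j * b) := by
    intro V u a b hu ha hb
    rw [hγ, map_mul, map_pow, map_zpow₀, ha, hb, ← zpow_natCast, ← zpow_mul, ← zpow_mul,
      ← zpow_add₀ hu.valuation_pos.ne']
    congr 1
    ring
  have hzero : ∀ Q : Place K (CurveE.FunctionField K q₀ m), Q.IsZero (CurveE.t K q₀ m) →
      ∃ u, Q.ring.HasUniformizer u ∧ Q.ring.valuation γ = Q.ring.valuation u ^ (i : ℤ) := by
    intro Q hQ
    obtain ⟨hu, h1⟩ := hasUniformizer_at_zero htop hz0 hn hz Q.algebraMap_mem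
      ((Q.isZero_iff _).1 hQ)
    refine ⟨_, hu, ?_⟩
    rw [hγval _ _ 1 0 hu (zpow_one _).symm (by rw [h1, zpow_zero])]
    congr 1
    ring
  have hneg : ∀ Q : Place K (CurveE.FunctionField K q₀ m), Q.IsZero (CurveE.t K q₀ m + 1) →
      ∃ u, Q.ring.HasUniformizer u ∧
        Q.ring.valuation γ = Q.ring.valuation u ^ ((i : ℤ) * r - j * n) := by
    intro Q hQ
    rw [hgn, hgr] at hz
    obtain ⟨u, hu, h1, h2⟩ := exists_hasUniformizer_at_neg_one htop hz0 hs0 hn0 hgK hrn hz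
      Q.algebraMap_mem ((Q.isZero_iff _).1 hQ)
    exact ⟨u, hu, hγval _ _ r n hu (by rw [h1, zpow_natCast]) (by rw [h2, zpow_natCast])⟩
  have htmem : ∀ Q : Place K (CurveE.FunctionField K q₀ m), Q ≠ Pinf →
      CurveE.t K q₀ m ∈ Q.ring := by
    intro Q hQ
    by_contra h
    exact hQ ((CurveE.existsUnique_isAtInfinity K q₀ m).unique
      ((CurveE.isAtInfinity_iff Q).2 h) hPinf)
  have hunit : ∀ Q : Place K (CurveE.FunctionField K q₀ m), Q ≠ Pinf →
      ¬ Q.IsZero (CurveE.t K q₀ m) → ¬ Q.IsZero (CurveE.t K q₀ m + 1) →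
      ∃ u, Q.ring.HasUniformizer u ∧ Q.ring.valuation γ = Q.ring.valuation u ^ (0 : ℤ) := by
    intro Q hQ h1 h2
    have ht := htmem Q hQ
    rw [Q.isZero_iff] at h1 h2
    have ht1 : Q.ring.valuation (CurveE.t K q₀ m) = 1 :=
      le_antisymm ((Q.ring.valuation_le_one_iff _).2 ht) (not_lt.1 h1)
    have hs1 : Q.ring.valuation (CurveE.t K q₀ m + 1) = 1 :=
      le_antisymm ((Q.ring.valuation_le_one_iff _).2 (Q.ring.add_mem _ _ ht Q.ring.one_mem))
        (not_lt.1 h2)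
    have hz1 : Q.ring.valuation (CurveE.z K q₀ m) = 1 := by
      rw [← pow_eq_one_iff_of_nonneg zero_le hn.ne', ← map_pow, hz, map_mul, map_pow, ht1, hs1,
        one_pow, mul_one]
    obtain ⟨u, hu⟩ := exists_hasUniformizer_of_pow_eq_aeval htr hnK
      (c := X * (X + 1) ^ (q₀ - 1)) (by simpa using hz) hz0 htop Q.ne_top Q.algebraMap_mem ht
    refine ⟨u, hu, ?_⟩
    rw [hγ, map_mul, map_pow, map_zpow₀, hz1, hs1, one_pow, one_zpow, one_mul, zpow_zero]
  obtain ⟨k, hk'⟩ := Int.eq_ofNat_of_zero_le hk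
  have hpole : Pinf.HasPoleDivisor γ k := by
    refine ⟨?_, fun Q hQ => ?_⟩
    · obtain ⟨u, hu, h1, h2⟩ := exists_hasUniformizer_at_infinity htop ht0 hs0 hn (by omega) hnm
        hz0 hz Pinf.algebraMap_mem ((CurveE.isAtInfinity_iff Pinf).1 hPinf)
      refine Pinf.hasOrd_of_valuation_eq hu ?_
      rw [hγval _ _ _ _ hu h1 h2, ← hk']
      congr 1
      ring
    · change γ ∈ Q.ring
      rw [← Q.ring.valuation_le_one_iff]
      by_cases h1 : Q.IsZero (CurveE.t K q₀ m)
      · obtain ⟨u, hu, h⟩ := hzero Q h1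
        rw [h, hu.zpow_le_one_iff]
        positivity
      by_cases h2 : Q.IsZero (CurveE.t K q₀ m + 1)
      · obtain ⟨u, hu, h⟩ := hneg Q h2
        rwa [h, hu.zpow_le_one_iff]
      · obtain ⟨u, hu, h⟩ := hunit Q hQ h1 h2
        rw [h, zpow_zero]
  refine ⟨k, hk'.symm, ⟨γ, hpole⟩, hpole, fun Q hQ => ⟨fun h => ?_, fun h => ?_, fun h1 h2 => ?_⟩⟩
  · obtain ⟨u, hu, hv⟩ := hzero Q h
    exact Q.hasOrd_of_valuation_eq hu hv
  · obtain ⟨u, hu, hv⟩ := hneg Q h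
    rw [hdiv]
    exact Q.hasOrd_of_valuation_eq hu hv
  · obtain ⟨u, hu, hv⟩ := hunit Q hQ h1 h2
    exact Q.hasOrd_of_valuation_eq hu hv
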